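/- Let $\Sigma_1,\Sigma_2$ be finite alphabets, and let $L_1\subseteq\Sigma_1^*$ and $L_2\subseteq\Sigma_2^*$ be context-free languages that are not inherently ambiguous (i.e. each $L_i$ is generated by some context-free grammar in which every word of the language has exactly one parse tree). Define the shuffle of two words recursively by $w ⧢ \epsilon=\epsilon ⧢ w=\{w\}$ and $uw_1 ⧢ vw_2=u\,(w_1 ⧢ vw_2)\cup v\,(uw_1 ⧢ w_2)$ for letters $u,v$, and let $$L_1 ⧢ L_2=\bigcup_{w_1\in L_1,\;w_2\in L_2} (w_1 ⧢ w_2)\subseteq(\Sigma_1\sqcup\Sigma_2)^*,$$ where the two alphabets are made disjoint (letters of the second alphabet are replaced by marked copies if necessary). Then the ordinary generating function $L(z)=\sum_{n\ge 0}\ell(n)z^n\in\mathbb{Q}[[z]]$ of $L=L_1 ⧢ L_2$, where $\ell(n)$ is the number of words of length $n$ in $L$, is D-finite: there are $r\ge 0$ and polynomials $p_0,\dots,p_r\in\mathbb{Q}[z]$ with $p_r\neq 0$ such that $p_r L^{(r)}+\dots+p_1L'+p_0L=0$. -/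

import Mathlib

namespace ContextFreeGrammar

/-- Ordered forests of parse trees of the grammar `g`, indexed by the string of root labels.
A leaf carries a terminal; an inner node carries a rule `r` of `g`, is labelled by the nonterminal
`r.input`, and its ordered children have root labels `r.output`. -/
inductive ParseForest {T : Type*} (g : ContextFreeGrammar T) : List (Symbol T g.NT) → Type _
  /-- The empty forest. -/
  | nil : ParseForest g []
  /-- A forest whose first tree is a single leaf. -/
  | leaf (a : T) {s : List (Symbol T g.NT)} (rest : ParseForest g s) :
      ParseForest g (Symbol.terminal a :: s)
  /-- A forest whose first tree is an inner node with the given children. -/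
  | node (r : ContextFreeRule T g.NT) (hr : r ∈ g.rules) (children : ParseForest g r.output)
      {s : List (Symbol T g.NT)} (rest : ParseForest g s) :
      ParseForest g (Symbol.nonterminal r.input :: s)

/-- The word read off the leaves of a forest, from left to right. -/
def ParseForest.yield {T : Type*} {g : ContextFreeGrammar T} :
    {s : List (Symbol T g.NT)} → ParseForest g s → List T
  | _, .nil => []
  | _, .leaf a rest => a :: rest.yield
  | _, .node _ _ children rest => children.yield ++ rest.yield

/-- A parse tree of `g`: one tree whose root is labelled by the initial nonterminal. -/
abbrev ParseTree {T : Type*} (g : ContextFreeGrammar T) : Type _ :=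
  ParseForest g [Symbol.nonterminal g.initial]

/-- A grammar is unambiguous if every word of its language has exactly one parse tree. -/
def IsUnambiguous {T : Type*} (g : ContextFreeGrammar T) : Prop :=
  ∀ w ∈ g.language, ∃! t : g.ParseTree, t.yield = w

end ContextFreeGrammar

namespace Language

/-- A context-free language is inherently ambiguous if every context-free grammar that generates
it is ambiguous. -/
def IsInherentlyAmbiguous {T : Type*} (L : Language T) : Prop :=
  L.IsContextFree ∧ ∀ g : ContextFreeGrammar T, g.language = L → ¬ g.IsUnambiguous

/-- The shuffle of two words: the set of all their interleavings, defined by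
`ε ⧢ w = w`, `w ⧢ ε = w` and `u w₁ ⧢ v w₂ = u (w₁ ⧢ v w₂) + v (u w₁ ⧢ w₂)` for letters `u`, `v`. -/
def shuffleWords {T : Type*} : List T → List T → Language T
  | [], w => {w}
  | u :: w₁, [] => {u :: w₁}
  | u :: w₁, v :: w₂ =>
      {[u]} * shuffleWords w₁ (v :: w₂) + {[v]} * shuffleWords (u :: w₁) w₂
  termination_by w₁ w₂ => w₁.length + w₂.length

/-- The shuffle of a language over `A` and a language over `B`, the two alphabets being made
disjoint: it is a language over the disjoint union `A ⊕ B`. -/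
def shuffle {A B : Type*} (L₁ : Language A) (L₂ : Language B) : Language (A ⊕ B) :=
  {w | ∃ w₁ ∈ L₁, ∃ w₂ ∈ L₂, w ∈ shuffleWords (w₁.map Sum.inl) (w₂.map Sum.inr)}

/-- The ordinary generating function `∑ ℓ(n) zⁿ` of a language (over a finite alphabet), where
`ℓ(n)` is the number of its words of length `n`. -/
noncomputable def generatingFunction {T : Type*} (L : Language T) : PowerSeries ℚ :=
  PowerSeries.mk fun n => ({w : List T | w ∈ L ∧ w.length = n}.ncard : ℚ)

end Language

/-- A formal power series `f` is D-finite if it satisfies a linear differential equation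
`p_r f⁽ʳ⁾ + ⋯ + p_1 f' + p_0 f = 0` with polynomial coefficients and `p_r ≠ 0`. -/
def PowerSeries.IsDFinite {K : Type*} [Field K] (f : PowerSeries K) : Prop :=
  ∃ (r : ℕ) (p : ℕ → Polynomial K), p r ≠ 0 ∧
    ∑ i ∈ Finset.range (r + 1), (p i : PowerSeries K) * (⇑(PowerSeries.derivative K))^[i] f = 0

/-! An interleaving of words over disjoint alphabets determines both words, and words of lengths i
and j have binom(i+j, i) interleavings. So the shuffle is counted by the binomial convolution of the
two counting sequences (`coeff_generatingFunction_shuffle`), that is, by a product of exponential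
generating functions. Passing between ordinary and exponential series multiplies or divides
coefficients by n!, which preserves P-recursiveness. Since D-finite means P-recursive coefficients,
and D-finite series are closed under products, `of_binomial_convolution` follows.

It remains to treat one unambiguous grammar. Counting trees by the length of their yield gives a
polynomial system y = P(z, y) over the productive unambiguous nonterminals
(`forestSeries_eq_ruleSystem`). If ∂P_X/∂Y is nonzero at the origin, every tree rooted at Y turns
into a larger tree rooted at X with the same yield. A cycle of such entries would contradict
unambiguity, so the Jacobian determinant of the system is nonzero at the origin. Then
`isDFinite_of_polynomial_system` applies: the solutions generate a finite extension of the rational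
functions, and all their derivatives stay inside it. -/

namespace PowerSeries

/-! ### D-finite power series and their products -/

open Polynomial
open scoped LaurentSeries RatFunc

variable {K : Type*} [Field K]

/-- By Leibniz the new coefficients are p_i' + p_{i-1}. The top one is p_r itself, so
differentiating an equation keeps it nontrivial in any characteristic. -/
lemma exists_derivative_sum_eq (f : K⟦X⟧) (r : ℕ) (p : ℕ → K[X]) :
    ∃ q : ℕ → K[X], q (r + 1) = p r ∧
      derivative K (∑ i ∈ Finset.range (r + 1), (p i : K⟦X⟧) * (⇑(derivative K))^[i] f) =
        ∑ i ∈ Finset.range (r + 2), (q i : K⟦X⟧) * (⇑(derivative K))^[i] f := by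
  refine ⟨fun i => (if i ≤ r then Polynomial.derivative (p i) else 0) +
    (match i with | 0 => 0 | j + 1 => p j), by simp, ?_⟩
  have h1 : ∑ i ∈ Finset.range (r + 2),
      (((if i ≤ r then Polynomial.derivative (p i) else 0 : K[X])) : K⟦X⟧) * (⇑(derivative K))^[i] f =
      ∑ i ∈ Finset.range (r + 1), (Polynomial.derivative (p i) : K⟦X⟧) * (⇑(derivative K))^[i] f := by
    rw [Finset.sum_range_succ]
    simp only [show ¬ (r + 1 ≤ r) by omega, if_false, Polynomial.coe_zero, zero_mul, add_zero]
    refine Finset.sum_congr rfl fun i hi => ?_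
    rw [if_pos (by simpa [Nat.lt_succ_iff] using hi)]
  simp only [Polynomial.coe_add, add_mul, Finset.sum_add_distrib, h1]
  rw [Finset.sum_range_succ' _ (r + 1)]
  simp only [Polynomial.coe_zero, zero_mul, add_zero, map_sum, ← Finset.sum_add_distrib]
  refine Finset.sum_congr rfl fun i _ => ?_
  rw [Derivation.leibniz, derivative_coe, Function.iterate_succ_apply', smul_eq_mul, smul_eq_mul]
  ring

lemma isDFinite_of_isDFinite_sum_eq (f : K⟦X⟧) (n r : ℕ) (p : ℕ → K[X]) (hr : p r ≠ 0)
    (h : (⇑(derivative K))^[n] (∑ i ∈ Finset.range (r + 1), (p i : K⟦X⟧) * (⇑(derivative K))^[i] f) = 0) : f.IsDFinite := by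
  induction n generalizing r p with
  | zero => exact ⟨r, p, hr, h⟩
  | succ n ih =>
    obtain ⟨q, hq, e⟩ := exists_derivative_sum_eq f r p
    exact ih (r + 1) q (hq ▸ hr) (by rw [← e, ← Function.iterate_succ_apply]; exact h)

lemma polynomial_smul_eq (p : K[X]) (f : K⟦X⟧) : p • f = (p : K⟦X⟧) * f := Algebra.smul_def _ _

lemma isDFinite_iff_not_linearIndependent (f : K⟦X⟧) :
    f.IsDFinite ↔ ¬ LinearIndependent K[X] (fun i : ℕ => (⇑(derivative K))^[i] f) := by
  constructor
  · rintro ⟨r, p, hr, h⟩ hli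
    rw [linearIndependent_iff'] at hli
    exact hr (hli (Finset.range (r + 1)) p (by simpa [polynomial_smul_eq] using h) r (by simp))
  · intro h
    rw [linearIndependent_iff'] at h
    push Not at h
    obtain ⟨s, p, h, i, hi, hpi⟩ := h
    classical
    have hne : (s.filter fun i => p i ≠ 0).Nonempty := ⟨i, by simp [hi, hpi]⟩
    set r := (s.filter fun i => p i ≠ 0).max' hne with hr
    have hrm := Finset.mem_filter.1 ((s.filter fun i => p i ≠ 0).max'_mem hne)
    rw [← hr] at hrm
    refine ⟨r, fun i => if i ∈ s then p i else 0, by simpa [hrm.1] using hrm.2, ?_⟩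
    rw [← h]
    simp only [polynomial_smul_eq]
    rw [← Finset.sum_filter_of_ne (s := s) (p := fun i => p i ≠ 0) (by
      intro j _ hj h0
      simp [h0] at hj)]
    symm
    refine Finset.sum_subset_zero_on_sdiff (fun j hj => ?_) (fun j hj => ?_) fun j hj => ?_
    · exact Finset.mem_range_succ_iff.2 (Finset.le_max' _ _ hj)
    · simp only [Finset.mem_sdiff, Finset.mem_filter, not_and, not_not] at hj
      by_cases h : j ∈ s
      · simp [h, hj.2 h]
      · simp [h]
    · simp [(Finset.mem_filter.1 hj).1]

lemma coe_polynomial_mul (p : K[X]) (f : K⟦X⟧) :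
    (((p : K⟦X⟧) * f : K⟦X⟧) : K⸨X⸩) = (algebraMap K[X] (RatFunc K) p) • (f : K⸨X⸩) := by
  rw [PowerSeries.coe_mul, Algebra.smul_def, ← IsScalarTower.algebraMap_apply]
  rfl

/-- A power series is D-finite iff its derivatives span a finite-dimensional space over the
rational functions. -/
lemma isDFinite_iff_exists_finiteDimensional (f : K⟦X⟧) :
    f.IsDFinite ↔ ∃ V : Submodule (RatFunc K) K⸨X⸩, V.FG ∧
      ∀ i, (((⇑(derivative K))^[i] f : K⟦X⟧) : K⸨X⸩) ∈ V := by
  constructor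
  · rintro ⟨r, p, hr, h⟩
    -- Differentiating n times gives an equation of exact order r + n. Dividing by its leading
    -- coefficient expresses that derivative through lower ones.
    have key : ∀ n, ∃ q : ℕ → K[X], q (r + n) ≠ 0 ∧
        ∑ i ∈ Finset.range (r + n + 1), (q i : K⟦X⟧) * (⇑(derivative K))^[i] f = 0 := by
      intro n
      induction n with
      | zero => exact ⟨p, hr, h⟩
      | succ n ih =>
        obtain ⟨q, hq, e⟩ := ih
        obtain ⟨q', hq', e'⟩ := exists_derivative_sum_eq f (r + n) q
        exact ⟨q', by rw [← add_assoc, hq']; exact hq, by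
          rw [← add_assoc, ← e', e, map_zero]⟩
    refine ⟨Submodule.span _ (Set.range fun i : Fin r => (((⇑(derivative K))^[i] f : K⟦X⟧) : K⸨X⸩)),
      Submodule.fg_span (Set.finite_range _), fun i => ?_⟩
    induction i using Nat.strong_induction_on with
    | _ i ih =>
      by_cases hi : i < r
      · exact Submodule.subset_span ⟨⟨i, hi⟩, rfl⟩
      obtain ⟨q, hq, e⟩ := key (i - r)
      rw [Nat.add_sub_cancel' (not_lt.1 hi)] at hq e
      have e' := congrArg (HahnSeries.ofPowerSeries ℤ K) e
      rw [Finset.sum_range_succ, map_add, map_sum, map_zero, coe_polynomial_mul,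
        add_comm] at e'
      have hq' : algebraMap K[X] (RatFunc K) (q i) ≠ 0 := by
        simpa using hq
      rw [← inv_smul_smul₀ hq' (HahnSeries.ofPowerSeries ℤ K ((⇑(derivative K))^[i] f)),
        eq_neg_of_add_eq_zero_left e']
      refine Submodule.smul_mem _ _ (Submodule.neg_mem _ (Submodule.sum_mem _ fun j hj => ?_))
      rw [coe_polynomial_mul]
      exact Submodule.smul_mem _ _ (ih j (Finset.mem_range.1 hj))
  · rintro ⟨V, hV, h⟩
    rw [isDFinite_iff_not_linearIndependent]
    intro hli
    have h1 : LinearIndependent K[X] (fun i : ℕ => (((⇑(derivative K))^[i] f : K⟦X⟧) : K⸨X⸩)) := by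
      let φ : K⟦X⟧ →ₗ[K[X]] K⸨X⸩ :=
        { toFun := fun f => (f : K⸨X⸩)
          map_add' := map_add _
          map_smul' := fun p f => by
            rw [polynomial_smul_eq, coe_polynomial_mul, algebraMap_smul]; rfl }
      exact hli.map' φ (LinearMap.ker_eq_bot.2 HahnSeries.ofPowerSeries_injective)
    -- Clearing denominators: independence over polynomials is independence over rational functions,
    -- impossible for an infinite family in a finite-dimensional space.
    rw [LinearIndependent.iff_fractionRing K[X] (RatFunc K)] at h1
    have : Module.Finite (RatFunc K) V := Module.Finite.of_fg hV
    have h2 : LinearIndependent (RatFunc K)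
        (fun i : ℕ => (⟨_, h i⟩ : V)) := LinearIndependent.of_comp V.subtype h1
    exact not_finite_iff_infinite.2 (inferInstance : Infinite ℕ) h2.finite

lemma IsDFinite.mul {f g : K⟦X⟧} (hf : f.IsDFinite) (hg : g.IsDFinite) : (f * g).IsDFinite := by
  rw [isDFinite_iff_exists_finiteDimensional] at *
  obtain ⟨V, hV, hf⟩ := hf
  obtain ⟨W, hW, hg⟩ := hg
  refine ⟨V * W, hV.mul hW, fun n => ?_⟩
  -- Generalising to products of derivatives lets Leibniz close the induction without a binomial
  -- formula.
  have : ∀ n i j, (((⇑(derivative K))^[n] ((⇑(derivative K))^[i] f * (⇑(derivative K))^[j] g) : K⟦X⟧) : K⸨X⸩) ∈ V * W := by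
    intro n
    induction n with
    | zero =>
      intro i j
      rw [Function.iterate_zero_apply, PowerSeries.coe_mul]
      exact Submodule.mul_mem_mul (hf i) (hg j)
    | succ n ih =>
      intro i j
      rw [Function.iterate_succ_apply, Derivation.leibniz, iterate_map_add, smul_eq_mul,
        smul_eq_mul, mul_comm ((⇑(derivative K))^[j] g), ← Function.iterate_succ_apply' (derivative K) i,
        ← Function.iterate_succ_apply' (derivative K) j, map_add]
      exact Submodule.add_mem _ (ih _ _) (ih _ _)
  exact this n 0 0

end PowerSeries

/-! ### P-recursive sequences and binomial convolution -/

/-- A sequence is P-recursive if it satisfies a nontrivial linear recurrence with polynomial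
coefficients. -/
def IsPRecursive {K : Type*} [Field K] (a : ℕ → K) : Prop :=
  ∃ (J : ℕ) (P : ℕ → Polynomial K), (∃ j ≤ J, P j ≠ 0) ∧
    ∀ n : ℕ, ∑ j ∈ Finset.range (J + 1), (P j).eval (n : K) * a (n + j) = 0

section PRecursive

open Polynomial
open scoped PowerSeries

variable {K : Type*} [Field K]

/-- The outer variable of P records the shift and the inner one the index n, so terms with equal
shift merge by themselves. -/
lemma IsPRecursive.of_lsum {a : ℕ → K} (P : K[X][X]) (hP : P ≠ 0)
    (h : ∀ n : ℕ, Polynomial.lsum (fun j => a (n + j) • Polynomial.leval (n : K)) P = 0) :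
    IsPRecursive a := by
  refine ⟨P.natDegree, P.coeff, ⟨_, le_rfl, by simpa using hP⟩, fun n => ?_⟩
  rw [← h n, Polynomial.lsum_apply, Polynomial.sum_over_range _ (by simp)]
  simp [mul_comm]

lemma eval_ascPochhammer_comp (i l n : ℕ) :
    ((ascPochhammer K i).comp (X + C ((l + 1 : ℕ) : K))).eval (n : K) =
      ((n + l + 1).ascFactorial i : K) := by
  rw [eval_comp, eval_add, eval_X, eval_C, ← Nat.cast_add, ← ascPochhammer_eval_cast,
    ascPochhammer_nat_eq_ascFactorial, add_assoc]

lemma monic_ascPochhammer_comp (i : ℕ) (c : K) : ((ascPochhammer K i).comp (X + C c)).Monic :=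
  (monic_ascPochhammer K i).comp_X_add_C c

lemma natDegree_ascPochhammer_comp (i : ℕ) (c : K) :
    ((ascPochhammer K i).comp (X + C c)).natDegree = i := by
  rw [natDegree_comp, ascPochhammer_natDegree, natDegree_X_add_C, mul_one]

lemma coeff_coe_polynomial_mul (p : K[X]) (g : K⟦X⟧) (D n : ℕ) (h : p.natDegree ≤ D) :
    PowerSeries.coeff (n + D) ((p : K⟦X⟧) * g) =
      ∑ l ∈ Finset.range (D + 1), p.coeff (D - l) * PowerSeries.coeff (n + l) g := by
  rw [PowerSeries.coeff_mul, Finset.Nat.sum_antidiagonal_eq_sum_range_succ_mk,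
    ← Finset.sum_range_reflect _ (D + 1)]
  refine (Finset.sum_subset (Finset.range_mono (show D + 1 ≤ n + D + 1 by omega))
    fun k _ hk => ?_).symm.trans ?_
  · rw [Polynomial.coeff_coe, Polynomial.coeff_eq_zero_of_natDegree_lt, zero_mul]
    simp only [Finset.mem_range] at hk
    omega
  · refine Finset.sum_congr rfl fun k hk => ?_
    simp only [Finset.mem_range] at hk
    rw [Polynomial.coeff_coe, show D - (D + 1 - 1 - k) = k by omega,
      show n + (D + 1 - 1 - k) = n + D - k by omega]

lemma IsPRecursive.of_isDFinite {f : K⟦X⟧} (hf : f.IsDFinite) :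
    IsPRecursive (fun n => PowerSeries.coeff n f) := by
  obtain ⟨r, p, hr, h⟩ := hf
  set D := (Finset.range (r + 1)).sup fun i => (p i).natDegree with hD
  have hpD : ∀ i ≤ r, (p i).natDegree ≤ D := fun i hi =>
    Finset.le_sup (f := fun i => (p i).natDegree) (by simpa [Nat.lt_succ_iff] using hi)
  let Q : ℕ → ℕ → K[X] := fun i l =>
    C ((p i).coeff (D - l)) * (ascPochhammer K i).comp (X + C ((l + 1 : ℕ) : K))
  refine IsPRecursive.of_lsum (∑ i ∈ Finset.range (r + 1), ∑ l ∈ Finset.range (D + 1),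
    Polynomial.monomial (l + i) (Q i l)) (fun h0 => ?_) fun n => ?_
  · obtain ⟨k, hk⟩ : ∃ k, (p r).coeff k ≠ 0 := by
      by_contra! H
      exact hr (Polynomial.ext (by simpa using H))
    have hkD : k ≤ D := (le_natDegree_of_ne_zero hk).trans (hpD r le_rfl)
    -- `Q i l` has degree at most i in the index, so inner degree r sees only i = r; the shift then
    -- forces l = D - k, leaving the coefficient of degree k of p_r.
    have h1 := congrArg (fun P : K[X][X] => (P.coeff (D - k + r)).coeff r) h0
    simp only [Polynomial.finsetSum_coeff, Polynomial.coeff_monomial, Polynomial.coeff_zero] at h1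
    rw [Finset.sum_range_succ, Finset.sum_eq_zero, zero_add,
      Finset.sum_eq_single_of_mem (D - k) (by simp)] at h1
    · rw [if_pos rfl, Polynomial.coeff_C_mul, Nat.sub_sub_self hkD] at h1
      have hm := (monic_ascPochhammer_comp r ((D - k + 1 : ℕ) : K)).coeff_natDegree
      rw [natDegree_ascPochhammer_comp] at hm
      rw [hm, mul_one] at h1
      exact hk h1
    · intro l _ hl
      rw [if_neg (by omega), Polynomial.coeff_zero]
    · intro i hi
      refine Finset.sum_eq_zero fun l _ => ?_
      split_ifs
      · have hm := Polynomial.coeff_eq_zero_of_natDegree_lt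
          ((natDegree_ascPochhammer_comp i ((l + 1 : ℕ) : K)).trans_lt (Finset.mem_range.1 hi))
        rw [Polynomial.coeff_C_mul, hm, mul_zero]
      · simp
  · have h2 := congrArg (PowerSeries.coeff (n + D)) h
    rw [map_sum, map_zero] at h2
    rw [map_sum, ← h2]
    refine Finset.sum_congr rfl fun i hi => ?_
    rw [coeff_coe_polynomial_mul _ _ D n (hpD i (by simpa [Nat.lt_succ_iff] using hi)),
      map_sum]
    refine Finset.sum_congr rfl fun l _ => ?_
    rw [PowerSeries.coeff_iterate_derivative, Polynomial.lsum_apply, Polynomial.sum_monomial_index _ _ (by simp),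
      LinearMap.smul_apply, leval_apply, eval_mul, eval_C, eval_ascPochhammer_comp, add_assoc n l i,
      smul_eq_mul]
    ring

lemma Polynomial.exists_eq_sum_descPochhammer (Q : K[X]) :
    ∃ q : ℕ →₀ K, Q = q.sum fun i c => C c * descPochhammer K i := by
  let S : Polynomial.Sequence K :=
    ⟨descPochhammer K, fun i => by
      rw [Polynomial.degree_eq_natDegree (monic_descPochhammer K i).ne_zero,
        descPochhammer_natDegree]⟩
  have hS : ∀ i, IsUnit (S i).leadingCoeff := fun i => by
    rw [show (S i).leadingCoeff = 1 from monic_descPochhammer K i]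
    exact isUnit_one
  refine ⟨(S.basis hS).repr Q, ?_⟩
  conv_lhs => rw [← (S.basis hS).linearCombination_repr Q]
  rw [Finsupp.linearCombination_apply]
  refine Finsupp.sum_congr fun i _ => ?_
  rw [Polynomial.Sequence.basis_eq_self, Polynomial.smul_eq_C_mul]

lemma coeff_X_pow_mul_iterate_derivative (f : K⟦X⟧) (n j J i : ℕ) (h : j ≤ J) :
    PowerSeries.coeff (n + J) ((PowerSeries.X : K⟦X⟧) ^ (J - j + i) * (⇑(PowerSeries.derivative K))^[i] f) =
      (descPochhammer K i).eval ((n + j : ℕ) : K) * PowerSeries.coeff (n + j) f := by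
  rw [PowerSeries.coeff_X_pow_mul', descPochhammer_eval_eq_descFactorial]
  split_ifs with hi
  · obtain ⟨m, hm⟩ : ∃ m, n + j = m + i := ⟨n + j - i, by omega⟩
    rw [show n + J - (J - j + i) = m by omega, PowerSeries.coeff_iterate_derivative, hm,
      Nat.add_descFactorial_eq_ascFactorial]
  · rw [Nat.descFactorial_of_lt (by omega)]
    simp

lemma IsPRecursive.isDFinite {f : K⟦X⟧} (h : IsPRecursive (fun n => PowerSeries.coeff n f)) :
    f.IsDFinite := by
  obtain ⟨J, P, ⟨j₀, hj₀, hP⟩, h⟩ := h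
  -- Falling factorials of n + j are the right basis: the operator X^i D^i multiplies the
  -- coefficient of degree m by the falling factorial of m of length i.
  choose q hq using fun j => Polynomial.exists_eq_sum_descPochhammer
    ((P j).comp (X - C (j : K)))
  obtain ⟨I, hI⟩ : ∃ I, ∀ j ≤ J, (q j).support ⊆ Finset.range (I + 1) := by
    refine ⟨(Finset.range (J + 1)).sup fun j => (q j).support.sup id, fun j hj i hi => ?_⟩
    rw [Finset.mem_range_succ_iff]
    exact (Finset.le_sup (f := id) hi).trans
      (Finset.le_sup (f := fun j => (q j).support.sup id) (Finset.mem_range_succ_iff.2 hj))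
  have hPe : ∀ j ≤ J, ∀ n : ℕ, (P j).eval (n : K) = ∑ i ∈ Finset.range (I + 1),
      q j i * (descPochhammer K i).eval ((n + j : ℕ) : K) := by
    intro j hj n
    have h1 := congrArg (Polynomial.eval ((n + j : ℕ) : K)) (hq j)
    rw [Polynomial.eval_comp] at h1
    simp only [eval_sub, eval_X, eval_C, Nat.cast_add, add_sub_cancel_right] at h1
    rw [h1, Finsupp.sum_of_support_subset _ (hI j hj) _ (by simp), Polynomial.eval_finsetSum]
    simp
  let p : ℕ → K[X] := fun i => ∑ j ∈ Finset.range (J + 1), C (q j i) * X ^ (J - j + i)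
  have hp : ∃ i ≤ I, p i ≠ 0 := by
    have hq0 : q j₀ ≠ 0 := by
      intro h0
      have h1 := hq j₀
      rw [h0, Finsupp.sum_zero_index] at h1
      apply hP
      have h2 := congrArg (fun R : K[X] => R.comp (X + C (j₀ : K))) h1
      simpa [Polynomial.comp_assoc] using h2
    obtain ⟨i, hi⟩ := Finsupp.ne_iff.1 hq0
    refine ⟨i, Finset.mem_range_succ_iff.1 (hI j₀ hj₀ (Finsupp.mem_support_iff.2 hi)), fun h0 => ?_⟩
    have h1 := congrArg (fun R : K[X] => R.coeff (J - j₀ + i)) h0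
    simp only [p, finsetSum_coeff, coeff_C_mul, coeff_X_pow, Polynomial.coeff_zero] at h1
    -- For fixed i the exponents J - j + i with j ≤ J are distinct, so no cancellation occurs.
    rw [Finset.sum_eq_single_of_mem j₀ (Finset.mem_range_succ_iff.2 hj₀)] at h1
    · simp at h1
      exact hi h1
    · intro j hj hne
      rw [Finset.mem_range_succ_iff] at hj
      rw [if_neg (by omega), mul_zero]
  have hG : ∀ n, PowerSeries.coeff (n + J)
      (∑ i ∈ Finset.range (I + 1), (p i : K⟦X⟧) * (⇑(PowerSeries.derivative K))^[i] f) = 0 := by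
    intro n
    rw [← h n, map_sum]
    have hc : ∀ i, (p i : K⟦X⟧) = ∑ j ∈ Finset.range (J + 1),
        ((C (q j i) * X ^ (J - j + i) : K[X]) : K⟦X⟧) := fun i => by
      simp only [p, ← Polynomial.coeToPowerSeries.ringHom_apply, map_sum]
    simp only [hc, Finset.sum_mul, map_sum]
    rw [Finset.sum_comm]
    refine Finset.sum_congr rfl fun j hj => ?_
    rw [Finset.mem_range_succ_iff] at hj
    rw [hPe j hj n, Finset.sum_mul]
    refine Finset.sum_congr rfl fun i _ => ?_
    rw [Polynomial.coe_mul, Polynomial.coe_C, Polynomial.coe_pow, Polynomial.coe_X, mul_assoc,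
      PowerSeries.coeff_C_mul, coeff_X_pow_mul_iterate_derivative _ _ _ _ _ hj, mul_assoc]
  classical
  obtain ⟨i₀, hi₀, hpi₀⟩ := hp
  have hr := Nat.findGreatest_spec (P := fun i => p i ≠ 0) hi₀ hpi₀
  set r := Nat.findGreatest (fun i => p i ≠ 0) I with hrdef
  -- The recurrence controls only coefficients from degree J on; the remaining polynomial of degree
  -- below J is killed by J derivatives.
  refine PowerSeries.isDFinite_of_isDFinite_sum_eq f J r p hr ?_
  rw [Finset.sum_subset (s₂ := Finset.range (I + 1))
    (Finset.range_mono (by simpa using Nat.findGreatest_le I))]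
  · ext n
    rw [PowerSeries.coeff_iterate_derivative, hG, mul_zero, map_zero]
  · intro i hi hi'
    simp only [Finset.mem_range, not_lt] at hi hi'
    have := Nat.findGreatest_is_greatest (P := fun i => p i ≠ 0) (n := I) (k := i)
      (by omega) (by omega)
    rw [not_not] at this
    simp [this]

lemma cast_ascFactorial_mul_factorial (n k : ℕ) :
    ((n + 1).ascFactorial k : K) * (n.factorial : K) = ((n + k).factorial : K) := by
  rw [← Nat.factorial_mul_ascFactorial]
  push_cast
  ring

/-- Divide the recurrence by n!: since (n+j)! = n!·(n+1)⋯(n+j), the correction factors are monic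
polynomials in n. -/
lemma IsPRecursive.div_factorial [CharZero K] {a : ℕ → K} (h : IsPRecursive a) :
    IsPRecursive (fun n => a n / (n.factorial : K)) := by
  obtain ⟨J, P, ⟨j₀, hj₀, hP⟩, h⟩ := h
  refine ⟨J, fun j => P j * (ascPochhammer K j).comp (X + C ((0 + 1 : ℕ) : K)),
    ⟨j₀, hj₀, mul_ne_zero hP (monic_ascPochhammer_comp _ _).ne_zero⟩, fun n => ?_⟩
  have hn : ∀ n : ℕ, (n.factorial : K) ≠ 0 := fun n => by exact_mod_cast n.factorial_ne_zero
  rw [← zero_div (n.factorial : K), ← h n, Finset.sum_div]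
  refine Finset.sum_congr rfl fun j _ => ?_
  simp only [eval_mul, eval_ascPochhammer_comp, add_zero]
  rw [← cast_ascFactorial_mul_factorial]
  have h1 := hn (n + j)
  rw [← cast_ascFactorial_mul_factorial] at h1
  have := left_ne_zero_of_mul h1
  have := hn n
  field_simp

/-- Multiply the recurrence by (n+J)!, the largest factorial involved, so that every quotient
(n+J)!/(n+j)! is polynomial in n. -/
lemma IsPRecursive.mul_factorial [CharZero K] {a : ℕ → K} (h : IsPRecursive a) :
    IsPRecursive (fun n => a n * (n.factorial : K)) := by
  obtain ⟨J, P, ⟨j₀, hj₀, hP⟩, h⟩ := h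
  refine ⟨J, fun j => P j * (ascPochhammer K (J - j)).comp (X + C ((j + 1 : ℕ) : K)),
    ⟨j₀, hj₀, mul_ne_zero hP (monic_ascPochhammer_comp _ _).ne_zero⟩, fun n => ?_⟩
  rw [← zero_mul ((n + J).factorial : K), ← h n, Finset.sum_mul]
  refine Finset.sum_congr rfl fun j hj => ?_
  rw [Finset.mem_range_succ_iff] at hj
  have := cast_ascFactorial_mul_factorial (K := K) (n + j) (J - j)
  rw [show n + j + (J - j) = n + J by omega] at this
  rw [eval_mul, eval_ascPochhammer_comp, ← this]
  ring

/-- The binomial convolution of two sequences with D-finite generating functions has a D-finite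
generating function. -/
lemma PowerSeries.IsDFinite.of_binomial_convolution [CharZero K] {f g h : K⟦X⟧} (hf : f.IsDFinite)
    (hg : g.IsDFinite)
    (hh : ∀ n, PowerSeries.coeff n h = ∑ k ∈ Finset.HasAntidiagonal.antidiagonal n,
      (n.choose k.1 : K) * (PowerSeries.coeff k.1 f * PowerSeries.coeff k.2 g)) :
    h.IsDFinite := by
  have egf : ∀ {u : K⟦X⟧}, u.IsDFinite →
      (PowerSeries.mk fun n => PowerSeries.coeff n u / (n.factorial : K)).IsDFinite := fun hu =>
    IsPRecursive.isDFinite (by simpa using (IsPRecursive.of_isDFinite hu).div_factorial)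
  refine IsPRecursive.isDFinite ?_
  have := (IsPRecursive.of_isDFinite ((egf hf).mul (egf hg))).mul_factorial
  convert this using 2 with n
  rw [hh, PowerSeries.coeff_mul, Finset.sum_mul]
  refine Finset.sum_congr rfl fun k hk => ?_
  have hn : ∀ n : ℕ, (n.factorial : K) ≠ 0 := fun n => by exact_mod_cast n.factorial_ne_zero
  rw [Finset.HasAntidiagonal.mem_antidiagonal] at hk
  have h1 := Nat.choose_mul_factorial_mul_factorial (n := n) (k := k.1) (by omega)
  rw [show n - k.1 = k.2 by omega] at h1
  rw [← h1, PowerSeries.coeff_mk, PowerSeries.coeff_mk]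
  have := hn k.1
  have := hn k.2
  push_cast
  field_simp

end PRecursive

/-! ### Polynomial systems with nonvanishing Jacobian -/

section PolynomialSystem

open scoped PowerSeries LaurentSeries RatFunc

lemma Derivation.map_eval₂ {R C A M σ : Type*} [CommRing R] [CommRing C] [CommRing A] [Algebra R A]
    [AddCommGroup M] [Module R M] [Module A M] [Fintype σ] (d : Derivation R A M) (φ : C →+* A)
    (hφ : ∀ c, d (φ c) = 0) (v : σ → A) (p : MvPolynomial σ C) :
    d (p.eval₂ φ v) = ∑ i, (MvPolynomial.pderiv i p).eval₂ φ v • d (v i) := by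
  classical
  induction p using MvPolynomial.induction_on with
  | C c => simp [hφ]
  | add p q hp hq => simp [MvPolynomial.eval₂_add, hp, hq, add_smul, Finset.sum_add_distrib]
  | mul_X p j hp =>
    rw [MvPolynomial.eval₂_mul, MvPolynomial.eval₂_X, Derivation.leibniz, hp, Finset.smul_sum]
    have h1 : ∀ i, MvPolynomial.pderiv i (p * MvPolynomial.X j) =
        MvPolynomial.X j * MvPolynomial.pderiv i p + p * (Pi.single j 1 : σ → MvPolynomial σ C) i := by
      intro i
      rw [Derivation.leibniz, MvPolynomial.pderiv_X, smul_eq_mul, smul_eq_mul, add_comm,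
        Pi.single_comm]
    simp only [h1, MvPolynomial.eval₂_add, MvPolynomial.eval₂_mul, MvPolynomial.eval₂_X, add_smul,
      Finset.sum_add_distrib, mul_smul]
    rw [add_comm]
    congr 1
    rw [Finset.sum_eq_single_of_mem j (Finset.mem_univ j)]
    · simp
    · intro i _ hi
      simp [Pi.single_eq_of_ne hi]

/-- The Jacobian matrix, with respect to the unknowns `some Y`, of the polynomial system
`X = P X`. -/
noncomputable def MvPolynomial.systemMatrix {C N : Type*} [CommRing C] [DecidableEq N]
    (P : N → MvPolynomial (Option N) C) : Matrix N N (MvPolynomial (Option N) C) :=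
  1 - Matrix.of fun X Y => MvPolynomial.pderiv (some Y) (P X)

/-- Differentiating the system gives a linear system for the d(y_X), solved by Cramer's rule.
Module-valued derivations are allowed so that it serves both d/dz and the universal derivation. -/
lemma Derivation.det_systemMatrix_smul {R C A M N : Type*} [CommRing R] [CommRing C] [CommRing A]
    [Algebra R A] [AddCommGroup M] [Module R M] [Module A M] [Fintype N] [DecidableEq N]
    (d : Derivation R A M) (φ : C →+* A) (hφ : ∀ c, d (φ c) = 0) (v : Option N → A)
    (P : N → MvPolynomial (Option N) C) (hv : ∀ X, v (some X) = (P X).eval₂ φ v) (Z : N) :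
    (MvPolynomial.systemMatrix P).det.eval₂ φ v • d (v (some Z)) =
      (∑ X, (MvPolynomial.systemMatrix P).adjugate Z X * MvPolynomial.pderiv none (P X)).eval₂ φ v •
        d (v none) := by
  set S := MvPolynomial.systemMatrix P with hS
  have h1 : ∀ X, ∑ Y, (S X Y).eval₂ φ v • d (v (some Y)) =
      (MvPolynomial.pderiv none (P X)).eval₂ φ v • d (v none) := by
    intro X
    have h2 := d.map_eval₂ φ hφ v (P X)
    rw [← hv X, Fintype.sum_option] at h2
    have h3 : ∀ Y, (S X Y).eval₂ φ v • d (v (some Y)) =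
        (if X = Y then d (v (some Y)) else 0) -
          (MvPolynomial.pderiv (some Y) (P X)).eval₂ φ v • d (v (some Y)) := by
      intro Y
      rw [hS, MvPolynomial.systemMatrix, Matrix.sub_apply, MvPolynomial.eval₂_sub, sub_smul,
        Matrix.one_apply, Matrix.of_apply]
      split_ifs <;> simp
    simp only [h3, Finset.sum_sub_distrib, Finset.sum_ite_eq, Finset.mem_univ, if_true]
    rw [h2, add_sub_cancel_right]
  have h4 : ∀ Y, ∑ X, S.adjugate Z X * S X Y = if Z = Y then S.det else 0 := by
    intro Y
    rw [← Matrix.mul_apply, Matrix.adjugate_mul, Matrix.smul_apply, Matrix.one_apply]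
    simp
  have ev : ∀ f : N → MvPolynomial (Option N) C, (∑ X, f X).eval₂ φ v = ∑ X, (f X).eval₂ φ v :=
    fun f => map_sum (MvPolynomial.eval₂Hom φ v) f _
  rw [ev, Finset.sum_smul]
  simp only [MvPolynomial.eval₂_mul, mul_smul, ← h1, Finset.smul_sum]
  rw [Finset.sum_comm]
  simp only [← mul_smul, ← MvPolynomial.eval₂_mul, ← Finset.sum_smul, ← ev, h4]
  rw [Finset.sum_eq_single_of_mem Z (Finset.mem_univ Z)]
  · rw [if_pos rfl]
  · intro Y _ hY
    rw [if_neg hY.symm, MvPolynomial.eval₂_zero, zero_smul]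

/-- Vanishing on generators makes all Kähler differentials vanish, so the extension is formally
unramified; being finitely generated as a field, it is finite. -/
lemma Algebra.EssFiniteType.finite_of_derivation_eq_zero {F E : Type*} [Field F] [Field E]
    [Algebra F E] (s : Set E) (hs : s.Finite) (htop : IntermediateField.adjoin F s = ⊤)
    (h : ∀ x ∈ s, KaehlerDifferential.D F E x = 0) : Module.Finite F E := by
  have h0 : ∀ x : E, KaehlerDifferential.D F E x = 0 := by
    intro x
    have hx : x ∈ IntermediateField.adjoin F s := htop ▸ IntermediateField.mem_top
    induction hx using IntermediateField.adjoin_induction with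
    | mem x hx => exact h x hx
    | algebraMap c => exact (KaehlerDifferential.D F E).map_algebraMap c
    | add x y _ _ hx hy => rw [map_add, hx, hy, add_zero]
    | inv x _ hx => rw [Derivation.leibniz_inv, hx, smul_zero]
    | mul x y _ _ hx hy => rw [Derivation.leibniz, hx, hy, smul_zero, smul_zero, add_zero]
  have : Subsingleton (Ω[E⁄F]) := by
    rw [← Submodule.subsingleton_iff E, ← subsingleton_iff_bot_eq_top,
      ← KaehlerDifferential.span_range_derivation, eq_comm, Submodule.span_eq_bot]
    rintro _ ⟨x, rfl⟩
    exact h0 x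
  have : Algebra.FormallyUnramified F E := ⟨this⟩
  have : Algebra.EssFiniteType F E :=
    IntermediateField.fg_top_iff.1 (htop ▸ IntermediateField.fg_adjoin_of_finite hs)
  exact Algebra.FormallyUnramified.finite_of_free F E

/-- A solution in an extension field of a polynomial system with nonzero Jacobian determinant
generates a finite extension. -/
lemma IntermediateField.finite_adjoin_of_polynomial_system {C F L N : Type*} [CommRing C] [Field F]
    [Field L] [Algebra F L] [Fintype N] [DecidableEq N] (φ : C →+* F) (t : F)
    (P : N → MvPolynomial (Option N) C) (y : N → L)
    (hy : ∀ X, y X = (P X).eval₂ ((algebraMap F L).comp φ) (fun o => o.elim (algebraMap F L t) y))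
    (hdet : (MvPolynomial.systemMatrix P).det.eval₂ ((algebraMap F L).comp φ)
      (fun o => o.elim (algebraMap F L t) y) ≠ 0) :
    Module.Finite F (IntermediateField.adjoin F (Set.range y)) := by
  set E := IntermediateField.adjoin F (Set.range y) with hE
  let yE : N → E := fun X => ⟨y X, IntermediateField.subset_adjoin _ _ ⟨X, rfl⟩⟩
  let vE : Option N → E := fun o => o.elim (algebraMap F E t) yE
  have hev : ∀ p : MvPolynomial (Option N) C, E.val (p.eval₂ ((algebraMap F E).comp φ) vE) =
      p.eval₂ ((algebraMap F L).comp φ) (fun o => o.elim (algebraMap F L t) y) := by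
    intro p
    refine (MvPolynomial.hom_eval₂ p _ (E.val : E →+* L) vE).trans ?_
    congr 1
    funext o
    cases o <;> rfl
  have htop : IntermediateField.adjoin F (Set.range yE) = ⊤ := by
    have h1 : (IntermediateField.adjoin F (Set.range yE)).map E.val = E := by
      rw [IntermediateField.adjoin_map, ← Set.range_comp]
      rfl
    apply IntermediateField.map_injective E.val
    rw [h1, ← AlgHom.fieldRange_eq_map, IntermediateField.fieldRange_val]
  refine Algebra.EssFiniteType.finite_of_derivation_eq_zero (Set.range yE) (Set.finite_range _)
    htop ?_
  rintro _ ⟨X, rfl⟩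
  have h1 := (KaehlerDifferential.D F E).det_systemMatrix_smul ((algebraMap F E).comp φ)
    (fun c => Derivation.map_algebraMap _ _) vE P
    (fun X => Subtype.ext ((hy X).trans (hev _).symm)) X
  -- Over F the parameter t is a constant, so Cramer's rule reads det · dy = 0.
  rw [show vE none = algebraMap F E t from rfl, Derivation.map_algebraMap, smul_zero,
    smul_eq_zero] at h1
  refine h1.resolve_left fun h0 => hdet ?_
  rw [← hev, h0, map_zero]

/-- The components of a power series solution of a polynomial system `y = P(z, y)` whose Jacobian
determinant does not vanish at the origin are D-finite. -/
theorem PowerSeries.isDFinite_of_polynomial_system {K N : Type*} [Field K] [Fintype N]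
    [DecidableEq N] (P : N → MvPolynomial (Option N) K) (y : N → K⟦X⟧)
    (hy : ∀ X, y X = (P X).eval₂ (PowerSeries.C (R := K)) (fun o => o.elim PowerSeries.X y))
    (hdet : PowerSeries.constantCoeff ((MvPolynomial.systemMatrix P).det.eval₂
      (PowerSeries.C (R := K)) (fun o => o.elim PowerSeries.X y)) ≠ 0) (Z : N) :
    (y Z).IsDFinite := by
  set v : Option N → K⟦X⟧ := fun o => o.elim PowerSeries.X y with hv
  set S := MvPolynomial.systemMatrix P with hS
  set ι : K⟦X⟧ →+* K⸨X⸩ := HahnSeries.ofPowerSeries ℤ K with hι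
  have hιinj : Function.Injective ι := HahnSeries.ofPowerSeries_injective
  let E := IntermediateField.adjoin (RatFunc K) (Set.range fun X => ι (y X))
  have hyE : ∀ X, ι (y X) ∈ E := fun X => IntermediateField.subset_adjoin _ _ ⟨X, rfl⟩
  have hXE : ∀ o, ι (v o) = o.elim (algebraMap (RatFunc K) K⸨X⸩ RatFunc.X) fun X => ι (y X) := by
    rintro (_ | X)
    · change ι PowerSeries.X = algebraMap (RatFunc K) K⸨X⸩ RatFunc.X
      rw [RatFunc.coe_X, hι, HahnSeries.ofPowerSeries_X]
    · rfl
  have hφ : ∀ c, ι (PowerSeries.C c) =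
      ((algebraMap (RatFunc K) K⸨X⸩).comp (algebraMap K (RatFunc K))) c := by
    intro c
    rw [RingHom.comp_apply, IsScalarTower.algebraMap_apply K (Polynomial K) (RatFunc K),
      ← IsScalarTower.algebraMap_apply (Polynomial K) (RatFunc K) K⸨X⸩]
    change _ = ι ((Polynomial.C c : Polynomial K) : K⟦X⟧)
    rw [Polynomial.coe_C]
  have hev : ∀ p : MvPolynomial (Option N) K, ι (p.eval₂ (PowerSeries.C (R := K)) v) =
      p.eval₂ ((algebraMap (RatFunc K) K⸨X⸩).comp (algebraMap K (RatFunc K)))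
        (fun o => o.elim (algebraMap (RatFunc K) K⸨X⸩ RatFunc.X) fun X => ι (y X)) := by
    intro p
    rw [MvPolynomial.hom_eval₂]
    congr 1
    · ext c : 1; exact hφ c
    · funext o; exact hXE o
  have hdet0 : S.det.eval₂ (PowerSeries.C (R := K)) v ≠ 0 := fun h => hdet (by rw [h, map_zero])
  have hfin : Module.Finite (RatFunc K) E := by
    refine IntermediateField.finite_adjoin_of_polynomial_system (algebraMap K (RatFunc K))
      RatFunc.X P _ (fun X => ?_) ?_
    · rw [← hev, ← hy X]
    · rw [← hev]
      exact (map_ne_zero_iff ι hιinj).2 hdet0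
  obtain ⟨u, hu⟩ : ∃ u, S.det.eval₂ (PowerSeries.C (R := K)) v * u = 1 :=
    (PowerSeries.isUnit_iff_constantCoeff.2 (isUnit_iff_ne_zero.2 hdet)).exists_right_inv
  -- With u the inverse of the Jacobian determinant, K[z, y, u] is stable under d/dz by Cramer's
  -- rule, and it embeds in the finite extension E.
  let G := Algebra.adjoin K (insert u (Set.range v))
  have hvG : ∀ o, v o ∈ G := fun o => Algebra.subset_adjoin (Or.inr ⟨o, rfl⟩)
  have huG : u ∈ G := Algebra.subset_adjoin (Or.inl rfl)
  have hpG : ∀ p : MvPolynomial (Option N) K, p.eval₂ (PowerSeries.C (R := K)) v ∈ G := by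
    intro p
    have : p.eval₂ (PowerSeries.C (R := K)) v ∈ Algebra.adjoin K (Set.range v) := by
      rw [Algebra.adjoin_range_eq_range_aeval]
      exact ⟨p, rfl⟩
    exact Algebra.adjoin_mono (Set.subset_insert _ _) this
  have hC : ∀ c, PowerSeries.derivative K (PowerSeries.C c) = 0 := fun c => PowerSeries.derivative_C
  have hDv : ∀ o, PowerSeries.derivative K (v o) ∈ G := by
    rintro (_ | X)
    · rw [show v none = PowerSeries.X from rfl, PowerSeries.derivative_X]
      exact G.one_mem
    · have h1 := (PowerSeries.derivative K).det_systemMatrix_smul (PowerSeries.C (R := K)) hC v P hy X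
      rw [show v none = PowerSeries.X from rfl, PowerSeries.derivative_X, smul_eq_mul, smul_eq_mul,
        mul_one, ← hS] at h1
      have h2 : ∀ a d w : K⟦X⟧, a * u = 1 → a * d = w → d = w * u := fun a d w h h' => by
        linear_combination u * h' - d * h
      rw [h2 _ _ _ hu h1]
      exact G.mul_mem (hpG _) huG
  have hDG : ∀ s ∈ G, PowerSeries.derivative K s ∈ G := by
    intro s hs
    induction hs using Algebra.adjoin_induction with
    | mem x hx =>
      rcases hx with rfl | ⟨o, rfl⟩
      · have h1 := congrArg (PowerSeries.derivative K) hu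
        rw [Derivation.leibniz, Derivation.map_one_eq_zero, smul_eq_mul, smul_eq_mul] at h1
        have h2 : PowerSeries.derivative K x = - (x * x *
            PowerSeries.derivative K (S.det.eval₂ (PowerSeries.C (R := K)) v)) := by
          linear_combination x * h1 - PowerSeries.derivative K x * hu
        rw [h2, Derivation.map_eval₂ _ _ hC]
        exact G.neg_mem (G.mul_mem (G.mul_mem huG huG)
          (G.sum_mem fun i _ => G.mul_mem (hpG _) (hDv i)))
      · exact hDv o
    | algebraMap c => exact (hC c).symm ▸ G.zero_mem
    | add x y _ _ hx hy => rw [map_add]; exact G.add_mem hx hy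
    | mul x y hx hy hx' hy' =>
      rw [Derivation.leibniz]
      exact G.add_mem (G.mul_mem hx hy') (G.mul_mem hy hx')
  have hvE : ∀ o, ι (v o) ∈ E := by
    intro o
    rw [hXE]
    cases o with
    | none => exact E.algebraMap_mem _
    | some X => exact hyE X
  have hDE : ι (S.det.eval₂ (PowerSeries.C (R := K)) v) ∈ E := by
    rw [MvPolynomial.eval₂_eq', map_sum]
    refine E.sum_mem fun i _ => ?_
    rw [map_mul, hφ, map_prod]
    refine E.mul_mem (E.algebraMap_mem _) (E.prod_mem fun o _ => ?_)
    rw [map_pow]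
    exact pow_mem (hvE o) _
  have hGE : ∀ s ∈ G, ι s ∈ E := by
    intro s hs
    induction hs using Algebra.adjoin_induction with
    | mem x hx =>
      rcases hx with rfl | ⟨o, rfl⟩
      · have h1 := congrArg ι hu
        rw [map_mul, map_one] at h1
        rw [eq_inv_of_mul_eq_one_right h1]
        exact E.inv_mem hDE
      · exact hvE o
    | algebraMap c =>
      change ι (PowerSeries.C c) ∈ E
      rw [hφ]
      exact E.algebraMap_mem _
    | add x y _ _ hx hy => rw [map_add]; exact E.add_mem hx hy
    | mul x y _ _ hx hy => rw [map_mul]; exact E.mul_mem hx hy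
  rw [isDFinite_iff_exists_finiteDimensional]
  refine ⟨E.toSubalgebra.toSubmodule, Module.Finite.iff_fg.1 hfin, fun i => hGE _ ?_⟩
  induction i with
  | zero => exact hvG (some Z)
  | succ i ih =>
    rw [Function.iterate_succ_apply']
    exact hDG _ ih

end PolynomialSystem

/-! ### Generating functions of types with a size -/

section SizeSeries

/-- The generating function of a type whose elements are counted by size. -/
noncomputable def sizeSeries {τ : Type*} (size : τ → ℕ) : PowerSeries ℚ :=
  PowerSeries.mk fun n => (Nat.card {t // size t = n} : ℚ)

lemma coeff_sizeSeries {τ : Type*} (size : τ → ℕ) (n : ℕ) :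
    PowerSeries.coeff n (sizeSeries size) = (Nat.card {t // size t = n} : ℚ) :=
  PowerSeries.coeff_mk _ _

lemma sizeSeries_congr {τ τ' : Type*} {size : τ → ℕ} {size' : τ' → ℕ} (e : τ ≃ τ')
    (he : ∀ t, size' (e t) = size t) : sizeSeries size = sizeSeries size' := by
  ext n
  rw [coeff_sizeSeries, coeff_sizeSeries]
  exact congrArg _ (Nat.card_congr (e.subtypeEquiv fun t => by rw [he]))

lemma sizeSeries_of_isEmpty {τ : Type*} [IsEmpty τ] (size : τ → ℕ) : sizeSeries size = 0 := by
  ext n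
  simp [coeff_sizeSeries]

lemma sizeSeries_zero_of_unique {τ : Type*} [Unique τ] : sizeSeries (fun _ : τ => 0) = 1 := by
  ext n
  rw [coeff_sizeSeries, PowerSeries.coeff_one]
  split_ifs with h
  · have : Unique {_t : τ // 0 = n} := ⟨⟨⟨default, h.symm⟩⟩, fun t => Subtype.ext (Subsingleton.elim _ _)⟩
    simp
  · have : IsEmpty {_t : τ // 0 = n} := ⟨fun t => h t.2.symm⟩
    simp

lemma sizeSeries_add_one {τ : Type*} (size : τ → ℕ) :
    sizeSeries (fun t => size t + 1) = PowerSeries.X * sizeSeries size := by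
  ext n
  cases n with
  | zero =>
    have : IsEmpty {t // size t + 1 = 0} := ⟨fun t => by have := t.2; omega⟩
    rw [coeff_sizeSeries, PowerSeries.coeff_zero_X_mul, Nat.card_of_isEmpty, Nat.cast_zero]
  | succ n =>
    rw [PowerSeries.coeff_succ_X_mul, coeff_sizeSeries, coeff_sizeSeries]
    simp

/-- Finite fibres matter, as `Nat.card` of an infinite type is 0. -/
lemma sizeSeries_prod {τ τ' : Type*} (size : τ → ℕ) (size' : τ' → ℕ)
    (h : ∀ n, Finite {t // size t = n}) (h' : ∀ n, Finite {t // size' t = n}) :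
    sizeSeries (fun p : τ × τ' => size p.1 + size' p.2) = sizeSeries size * sizeSeries size' := by
  ext n
  rw [PowerSeries.coeff_mul, coeff_sizeSeries]
  simp only [coeff_sizeSeries]
  let e : {p : τ × τ' // size p.1 + size' p.2 = n} ≃
      Σ k : {k : ℕ × ℕ // k ∈ Finset.HasAntidiagonal.antidiagonal n},
        {t // size t = k.1.1} × {t // size' t = k.1.2} :=
    { toFun := fun p => ⟨⟨(size p.1.1, size' p.1.2), Finset.HasAntidiagonal.mem_antidiagonal.2 p.2⟩,
        ⟨p.1.1, rfl⟩, ⟨p.1.2, rfl⟩⟩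
      invFun := fun q => ⟨(q.2.1.1, q.2.2.1), by
        rw [q.2.1.2, q.2.2.2]; exact Finset.HasAntidiagonal.mem_antidiagonal.1 q.1.2⟩
      left_inv := fun p => rfl
      right_inv := by
        rintro ⟨⟨⟨a, b⟩, hk⟩, ⟨t, ht⟩, ⟨t', ht'⟩⟩
        dsimp only at ht ht'
        subst ht ht'
        rfl }
  rw [Nat.card_congr e, Nat.card_sigma]
  simp only [Nat.card_prod]
  push_cast
  exact Finset.sum_coe_sort (Finset.HasAntidiagonal.antidiagonal n) fun k =>
    (Nat.card {t // size t = k.1} : ℚ) * (Nat.card {t // size' t = k.2} : ℚ)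

lemma sizeSeries_sigma {ι : Type*} [Fintype ι] {τ : ι → Type*} (size : ∀ i, τ i → ℕ)
    (h : ∀ i n, Finite {t // size i t = n}) :
    sizeSeries (fun p : Σ i, τ i => size p.1 p.2) = ∑ i, sizeSeries (size i) := by
  ext n
  rw [map_sum, coeff_sizeSeries]
  simp only [coeff_sizeSeries]
  let e : {p : Σ i, τ i // size p.1 p.2 = n} ≃ Σ i, {t // size i t = n} :=
    { toFun := fun p => ⟨p.1.1, p.1.2, p.2⟩
      invFun := fun q => ⟨⟨q.1, q.2.1⟩, q.2.2⟩
      left_inv := fun p => rfl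
      right_inv := fun q => rfl }
  rw [Nat.card_congr e, Nat.card_sigma]
  push_cast
  rfl

end SizeSeries

/-! ### Parse forests and the polynomial system of a grammar -/

namespace ContextFreeGrammar

variable {T : Type*} {g : ContextFreeGrammar T}

/-- Juxtaposition of forests. -/
def ParseForest.append : {s : List (Symbol T g.NT)} → ParseForest g s →
    {s' : List (Symbol T g.NT)} → ParseForest g s' → ParseForest g (s ++ s')
  | _, .nil, _, f => f
  | _, .leaf a rest, _, f => .leaf a (rest.append f)
  | _, .node r hr children rest, _, f => .node r hr children (rest.append f)

/-- The number of inner nodes of a forest. -/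
def ParseForest.numNodes : {s : List (Symbol T g.NT)} → ParseForest g s → ℕ
  | _, .nil => 0
  | _, .leaf _ rest => rest.numNodes
  | _, .node _ _ children rest => children.numNodes + rest.numNodes + 1

lemma ParseForest.yield_append {s s' : List (Symbol T g.NT)} (t : ParseForest g s)
    (t' : ParseForest g s') : (t.append t').yield = t.yield ++ t'.yield := by
  induction t with
  | nil => rfl
  | leaf a rest ih => simp [ParseForest.append, ParseForest.yield, ih]
  | node r hr children rest _ ih => simp [ParseForest.append, ParseForest.yield, ih]

lemma ParseForest.numNodes_append {s s' : List (Symbol T g.NT)} (t : ParseForest g s)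
    (t' : ParseForest g s') : (t.append t').numNodes = t.numNodes + t'.numNodes := by
  induction t with
  | nil => simp [ParseForest.append, ParseForest.numNodes]
  | leaf a rest ih => simp [ParseForest.append, ParseForest.numNodes, ih]
  | node r hr children rest _ ih =>
    simp only [ParseForest.append, ParseForest.numNodes, ih]
    omega

/-- A forest with no symbols is empty. -/
instance : Unique (ParseForest g []) := ⟨⟨.nil⟩, fun t => by cases t; rfl⟩

/-- Removing the leading leaf of a forest. -/
def ParseForest.leafEquiv (a : T) (s : List (Symbol T g.NT)) :
    ParseForest g (Symbol.terminal a :: s) ≃ ParseForest g s where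
  toFun | .leaf _ rest => rest
  invFun t := .leaf a t
  left_inv t := by cases t; rfl
  right_inv t := rfl

/-- Separating the first tree of a forest from the others. -/
def ParseForest.consEquiv (X : g.NT) (s : List (Symbol T g.NT)) :
    ParseForest g (Symbol.nonterminal X :: s) ≃
      ParseForest g [Symbol.nonterminal X] × ParseForest g s where
  toFun | .node r hr children rest => (.node r hr children .nil, rest)
  invFun p := p.1.append p.2
  left_inv t := by cases t; rfl
  right_inv := by
    rintro ⟨t, t'⟩
    cases t with
    | node r hr children rest => cases rest; rfl

open Classical in
/-- A tree is given by the rule at its root and the forest of its children. -/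
def ParseForest.nodeEquiv (X : g.NT) :
    ParseForest g [Symbol.nonterminal X] ≃
      Σ r : {r // r ∈ g.rules.filter fun r => r.input = X}, ParseForest g r.1.output where
  toFun | .node r hr children .nil => ⟨⟨r, Finset.mem_filter.2 ⟨hr, rfl⟩⟩, children⟩
  invFun
  | ⟨⟨r, hr⟩, children⟩ =>
    (Finset.mem_filter.1 hr).2 ▸ .node r (Finset.mem_filter.1 hr).1 children .nil
  left_inv t := by
    cases t with
    | node r hr children rest => cases rest; rfl
  right_inv := by
    rintro ⟨⟨r, hr⟩, children⟩
    obtain ⟨hr, rfl⟩ := Finset.mem_filter.1 hr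
    rfl

lemma ParseForest.derives_yield {s : List (Symbol T g.NT)} (t : ParseForest g s) :
    g.Derives s (t.yield.map Symbol.terminal) := by
  induction t with
  | nil => exact Derives.refl _
  | leaf a rest ih => exact ih.append_left [Symbol.terminal a]
  | @node r hr children s rest ihc ih =>
    have h1 : g.Derives [Symbol.nonterminal r.input] r.output :=
      Produces.single ⟨r, hr, ContextFreeRule.Rewrites.input_output⟩
    rw [ParseForest.yield, List.map_append]
    exact ((h1.trans ihc).append_right s).trans (ih.append_left _)

variable (g) in
/-- Every word is the yield of at most one forest with root labels `s`. -/
def YieldInjective (s : List (Symbol T g.NT)) : Prop :=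
  Function.Injective (ParseForest.yield : ParseForest g s → List T)

variable (g) in
/-- The generating function of the forests with root labels `s`, counted by length of the yield. -/
noncomputable def forestSeries (s : List (Symbol T g.NT)) : PowerSeries ℚ :=
  sizeSeries fun t : ParseForest g s => t.yield.length

variable (g) in
/-- The nonterminals which produce some word, and each word in only one way. -/
def IsGood (X : g.NT) : Prop :=
  YieldInjective g [Symbol.nonterminal X] ∧ Nonempty (ParseForest g [Symbol.nonterminal X])

lemma YieldInjective.finite [Finite T] {s : List (Symbol T g.NT)} (h : YieldInjective g s) (n : ℕ) :
    Finite {t : ParseForest g s // t.yield.length = n} := by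
  have : Finite {w : List T // w.length = n} := (List.finite_length_eq T n).to_subtype
  exact Finite.of_injective
    (fun t => (⟨t.1.yield, t.2⟩ : {w : List T // w.length = n}))
    fun t t' e => Subtype.ext (h (congrArg Subtype.val e))

lemma YieldInjective.output {X : g.NT} (h : YieldInjective g [Symbol.nonterminal X])
    {r : ContextFreeRule T g.NT} (hr : r ∈ g.rules) (hX : r.input = X) :
    YieldInjective g r.output := by
  subst hX
  intro t₁ t₂ e
  have := @h (.node r hr t₁ .nil) (.node r hr t₂ .nil) (by simp [ParseForest.yield, e])
  cases this
  rfl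

/-- Each part is tested by completing it with a fixed forest of the other, hence the witnesses `t`
and `t'`. -/
lemma YieldInjective.cons_nonterminal {X : g.NT} {s : List (Symbol T g.NT)}
    (h : YieldInjective g (Symbol.nonterminal X :: s))
    (t : ParseForest g [Symbol.nonterminal X]) (t' : ParseForest g s) :
    YieldInjective g [Symbol.nonterminal X] ∧ YieldInjective g s := by
  constructor
  · intro t₁ t₂ e
    exact congrArg Prod.fst ((ParseForest.consEquiv X s).symm.injective
      (a₁ := (t₁, t')) (a₂ := (t₂, t')) (h (by
        change (t₁.append t').yield = (t₂.append t').yield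
        rw [ParseForest.yield_append, ParseForest.yield_append, e])))
  · intro t₁ t₂ e
    exact congrArg Prod.snd ((ParseForest.consEquiv X s).symm.injective
      (a₁ := (t, t₁)) (a₂ := (t, t₂)) (h (by
        change (t.append t₁).yield = (t.append t₂).yield
        rw [ParseForest.yield_append, ParseForest.yield_append, e])))

lemma forestSeries_nil : forestSeries g [] = 1 := by
  rw [← sizeSeries_zero_of_unique (τ := ParseForest g [])]
  exact sizeSeries_congr (Equiv.refl _) fun t => by cases t; rfl

lemma forestSeries_terminal (a : T) (s : List (Symbol T g.NT)) :
    forestSeries g (Symbol.terminal a :: s) = PowerSeries.X * forestSeries g s := by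
  rw [forestSeries, forestSeries, ← sizeSeries_add_one]
  exact sizeSeries_congr (ParseForest.leafEquiv a s) fun t => by cases t; rfl

lemma forestSeries_nonterminal [Finite T] {X : g.NT} {s : List (Symbol T g.NT)}
    (hX : YieldInjective g [Symbol.nonterminal X]) (hs : YieldInjective g s) :
    forestSeries g (Symbol.nonterminal X :: s) =
      forestSeries g [Symbol.nonterminal X] * forestSeries g s := by
  rw [forestSeries, forestSeries, forestSeries, ← sizeSeries_prod _ _ hX.finite hs.finite]
  refine (sizeSeries_congr (ParseForest.consEquiv X s).symm fun p => ?_).symm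
  change (p.1.append p.2).yield.length = _
  rw [ParseForest.yield_append, List.length_append]

open Classical in
lemma forestSeries_eq_sum [Finite T] {X : g.NT} (hX : YieldInjective g [Symbol.nonterminal X]) :
    forestSeries g [Symbol.nonterminal X] =
      ∑ r ∈ g.rules.filter fun r => r.input = X, forestSeries g r.output := by
  rw [← Finset.sum_coe_sort]
  simp only [forestSeries]
  rw [← sizeSeries_sigma]
  · refine sizeSeries_congr (ParseForest.nodeEquiv X) fun t => ?_
    cases t with
    | node r hr children rest =>
      cases rest
      change children.yield.length = (children.yield ++ []).length
      rw [List.append_nil]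
  · intro r n
    obtain ⟨hr, hrX⟩ := Finset.mem_filter.1 r.2
    exact (hX.output hr hrX).finite n

variable (g) in
open Classical in
/-- The polynomial attached to a symbol: the variable `none` for a terminal, the variable of `X`
for a good nonterminal `X`, zero for any other nonterminal. -/
noncomputable def symbolPolynomial :
    Symbol T g.NT → MvPolynomial (Option {X // IsGood g X}) ℚ
  | .terminal _ => MvPolynomial.X none
  | .nonterminal X => if h : IsGood g X then MvPolynomial.X (some ⟨X, h⟩) else 0

variable (g) in
/-- The values of the variables at the generating functions of the good nonterminals. -/
noncomputable def seriesValuation (o : Option {X // IsGood g X}) : PowerSeries ℚ :=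
  o.elim PowerSeries.X fun X => forestSeries g [Symbol.nonterminal X.1]

variable (g) in
/-- Evaluation of polynomials at the generating functions of the good nonterminals. -/
noncomputable def seriesEval : MvPolynomial (Option {X // IsGood g X}) ℚ →+* PowerSeries ℚ :=
  MvPolynomial.eval₂Hom PowerSeries.C (seriesValuation g)

lemma seriesEval_terminal (a : T) :
    seriesEval g (symbolPolynomial g (.terminal a)) = PowerSeries.X := by
  simp [seriesEval, symbolPolynomial, seriesValuation]

lemma seriesEval_nonterminal {X : g.NT} (h : IsGood g X) :
    seriesEval g (symbolPolynomial g (.nonterminal X)) =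
      forestSeries g [Symbol.nonterminal X] := by
  simp [seriesEval, symbolPolynomial, seriesValuation, h]

/-- Some symbol produces nothing, hence is a nonterminal that is not good and contributes the factor
0. -/
lemma prod_seriesEval_eq_zero (s : List (Symbol T g.NT)) (h : IsEmpty (ParseForest g s)) :
    seriesEval g (s.map (symbolPolynomial g)).prod = 0 := by
  induction s with
  | nil => exact (h.false .nil).elim
  | cons x s ih =>
    rw [List.map_cons, List.prod_cons, map_mul]
    cases x with
    | terminal a => rw [ih ((ParseForest.leafEquiv a s).symm.isEmpty), mul_zero]
    | nonterminal X =>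
      rcases isEmpty_or_nonempty (ParseForest g s) with hs | ⟨⟨t'⟩⟩
      · rw [ih hs, mul_zero]
      · have : ¬ IsGood g X := fun ⟨_, ⟨t⟩⟩ => h.false (t.append t')
        rw [symbolPolynomial, dif_neg this, map_zero, zero_mul]

lemma forestSeries_eq_prod [Finite T] (s : List (Symbol T g.NT)) (h : YieldInjective g s) :
    forestSeries g s = seriesEval g (s.map (symbolPolynomial g)).prod := by
  induction s with
  | nil => rw [forestSeries_nil, List.map_nil, List.prod_nil, map_one]
  | cons x s ih =>
    -- Injectivity passes to the factors only when a forest exists; otherwise both sides are 0.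
    rcases isEmpty_or_nonempty (ParseForest g (x :: s)) with he | ⟨⟨t⟩⟩
    · rw [prod_seriesEval_eq_zero _ he, forestSeries, sizeSeries_of_isEmpty]
    rw [List.map_cons, List.prod_cons, map_mul]
    cases x with
    | terminal a =>
      rw [forestSeries_terminal, seriesEval_terminal, ih]
      intro t₁ t₂ e
      exact (ParseForest.leafEquiv a s).symm.injective (h (by
        change a :: t₁.yield = a :: t₂.yield
        rw [e]))
    | nonterminal X =>
      obtain ⟨t₁, t₂⟩ := ParseForest.consEquiv X s t
      obtain ⟨hX, hs⟩ := h.cons_nonterminal t₁ t₂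
      rw [forestSeries_nonterminal hX hs, seriesEval_nonterminal ⟨hX, ⟨t₁⟩⟩, ih hs]

variable (g) in
open Classical in
/-- The right-hand sides of the polynomial system satisfied by the generating functions of the
good nonterminals. -/
noncomputable def ruleSystem (X : {X // IsGood g X}) :
    MvPolynomial (Option {X // IsGood g X}) ℚ :=
  ∑ r ∈ g.rules.filter fun r => r.input = X.1, (r.output.map (symbolPolynomial g)).prod

lemma forestSeries_eq_ruleSystem [Finite T] (X : {X // IsGood g X}) :
    forestSeries g [Symbol.nonterminal X.1] = seriesEval g (ruleSystem g X) := by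
  classical
  rw [forestSeries_eq_sum X.2.1, ruleSystem, map_sum]
  refine Finset.sum_congr rfl fun r hr => ?_
  obtain ⟨hr, hrX⟩ := Finset.mem_filter.1 hr
  exact forestSeries_eq_prod _ (X.2.1.output hr hrX)

lemma exists_yield_eq_nil_of_symbol (x : Symbol T g.NT)
    (h : PowerSeries.constantCoeff (seriesEval g (symbolPolynomial g x)) ≠ 0) :
    ∃ t : ParseForest g [x], t.yield = [] := by
  cases x with
  | terminal a => rw [seriesEval_terminal] at h; simp at h
  | nonterminal X =>
    by_cases hX : IsGood g X
    · rw [seriesEval_nonterminal hX, ← PowerSeries.coeff_zero_eq_constantCoeff_apply, forestSeries,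
        coeff_sizeSeries, Nat.cast_ne_zero, Nat.card_ne_zero] at h
      obtain ⟨⟨t, ht⟩⟩ := h.1
      exact ⟨t, List.length_eq_zero_iff.1 ht⟩
    · rw [symbolPolynomial, dif_neg hX] at h
      simp at h

lemma exists_yield_eq_nil (s : List (Symbol T g.NT))
    (h : PowerSeries.constantCoeff (seriesEval g (s.map (symbolPolynomial g)).prod) ≠ 0) :
    ∃ t : ParseForest g s, t.yield = [] := by
  induction s with
  | nil => exact ⟨.nil, rfl⟩
  | cons x s ih =>
    rw [List.map_cons, List.prod_cons, map_mul, map_mul] at h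
    obtain ⟨t, ht⟩ := exists_yield_eq_nil_of_symbol x (left_ne_zero_of_mul h)
    obtain ⟨t', ht'⟩ := ih (right_ne_zero_of_mul h)
    exact ⟨t.append t', (t.yield_append t').trans (by rw [ht, ht']; rfl)⟩

/-- A nonzero constant term of the derivative means that some occurrence of Y in s has only symbols
deriving the empty word around it. Put `t` there and trees of empty yield elsewhere. -/
lemma exists_yield_eq_of_pderiv_ne_zero (s : List (Symbol T g.NT)) (Y : {X // IsGood g X})
    (h : PowerSeries.constantCoeff (seriesEval g
      (MvPolynomial.pderiv (some Y) (s.map (symbolPolynomial g)).prod)) ≠ 0)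
    (t : ParseForest g [Symbol.nonterminal Y.1]) :
    ∃ t' : ParseForest g s, t'.yield = t.yield ∧ t.numNodes ≤ t'.numNodes := by
  induction s with
  | nil => simp at h
  | cons x s ih =>
    rw [List.map_cons, List.prod_cons, Derivation.leibniz, smul_eq_mul, smul_eq_mul, map_add,
      map_add, map_mul, map_mul, map_mul, map_mul] at h
    by_cases h1 : PowerSeries.constantCoeff (seriesEval g (symbolPolynomial g x)) *
      PowerSeries.constantCoeff (seriesEval g
        (MvPolynomial.pderiv (some Y) (s.map (symbolPolynomial g)).prod)) = 0
    · rw [h1, zero_add] at h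
      obtain ⟨t₀, ht₀⟩ := exists_yield_eq_nil s (left_ne_zero_of_mul h)
      have h2 := right_ne_zero_of_mul h
      cases x with
      | terminal a => simp [symbolPolynomial] at h2
      | nonterminal X =>
        have hX : IsGood g X := by
          by_contra hX
          rw [symbolPolynomial, dif_neg hX] at h2
          simp at h2
        have hXY : Y = ⟨X, hX⟩ := by
          by_contra hXY
          rw [symbolPolynomial, dif_pos hX, MvPolynomial.pderiv_X_of_ne] at h2
          · simp at h2
          · intro e
            exact hXY (Option.some_injective _ e).symm
        subst hXY
        exact ⟨t.append t₀, (t.yield_append t₀).trans (by rw [ht₀, List.append_nil]),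
          (Nat.le_add_right _ _).trans (t.numNodes_append t₀).ge⟩
    · obtain ⟨t₀, ht₀⟩ := exists_yield_eq_nil_of_symbol x (left_ne_zero_of_mul h1)
      obtain ⟨t', ht', hn⟩ := ih (right_ne_zero_of_mul h1)
      exact ⟨t₀.append t', (t₀.yield_append t').trans (by rw [ht₀, ht']; rfl),
        (hn.trans (Nat.le_add_left _ _)).trans (t₀.numNodes_append t').ge⟩

lemma exists_yield_eq_of_pderiv_ruleSystem_ne_zero (X Y : {X // IsGood g X})
    (h : PowerSeries.constantCoeff (seriesEval g
      (MvPolynomial.pderiv (some Y) (ruleSystem g X))) ≠ 0)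
    (t : ParseForest g [Symbol.nonterminal Y.1]) :
    ∃ t' : ParseForest g [Symbol.nonterminal X.1],
      t'.yield = t.yield ∧ t.numNodes < t'.numNodes := by
  classical
  rw [ruleSystem, map_sum, map_sum, map_sum] at h
  obtain ⟨r, hr, h⟩ := Finset.exists_ne_zero_of_sum_ne_zero h
  obtain ⟨t', ht', hn⟩ := exists_yield_eq_of_pderiv_ne_zero _ _ h t
  obtain ⟨X, hX⟩ := X
  obtain ⟨hrg, rfl⟩ := Finset.mem_filter.1 hr
  -- The new root makes the inequality strict.
  refine ⟨.node r hrg t' .nil, by simp [ParseForest.yield, ht'], ?_⟩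
  simp only [ParseForest.numNodes]
  omega

/-- A nonterminal with a tree is the input of one of the finitely many rules; the type of all
nonterminals may be infinite. -/
lemma finite_setOf_isGood : Finite {X // IsGood g X} := by
  have : {X | IsGood g X} ⊆ ContextFreeRule.input '' (g.rules : Set (ContextFreeRule T g.NT)) := by
    rintro X ⟨_, ⟨t⟩⟩
    cases t with
    | node r hr children rest => exact ⟨r, hr, rfl⟩
  exact ((g.rules.finite_toSet.image _).subset this).to_subtype

end ContextFreeGrammar

/-- A kernel vector satisfies v = Mv, and each entry of Mv involves only smaller indices, so v
vanishes by well-founded induction. -/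
lemma Matrix.det_one_sub_ne_zero_of_wellFounded {N K : Type*} [Fintype N] [DecidableEq N] [Field K]
    (M : Matrix N N K) (r : N → N → Prop) (hr : WellFounded r) (h : ∀ X Y, M X Y ≠ 0 → r Y X) :
    (1 - M).det ≠ 0 := by
  intro h0
  obtain ⟨v, hv, e⟩ := Matrix.exists_mulVec_eq_zero_iff.2 h0
  refine hv (funext fun X => ?_)
  induction X using hr.induction with
  | _ X ih =>
    have h1 := congrFun e X
    rw [Matrix.sub_mulVec, Matrix.one_mulVec, Pi.sub_apply, Pi.zero_apply, sub_eq_zero] at h1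
    rw [h1, Matrix.mulVec, dotProduct]
    refine Finset.sum_eq_zero fun Y _ => ?_
    by_cases hM : M X Y = 0
    · rw [hM, zero_mul]
    · rw [ih Y (h X Y hM), Pi.zero_apply, mul_zero]

/-! ### Unambiguous grammars have D-finite generating functions -/

namespace ContextFreeGrammar

variable {T : Type*} {g : ContextFreeGrammar T}

theorem isDFinite_forestSeries [Finite T] {X : g.NT} (hX : IsGood g X) :
    (forestSeries g [Symbol.nonterminal X]).IsDFinite := by
  classical
  have := finite_setOf_isGood (g := g)
  have := Fintype.ofFinite {X // IsGood g X}
  refine PowerSeries.isDFinite_of_polynomial_system (ruleSystem g)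
    (fun X => forestSeries g [Symbol.nonterminal X.1]) forestSeries_eq_ruleSystem ?_ ⟨X, hX⟩
  let κ := (PowerSeries.constantCoeff (R := ℚ)).comp (seriesEval g)
  change κ (MvPolynomial.systemMatrix (ruleSystem g)).det ≠ 0
  rw [RingHom.map_det, MvPolynomial.systemMatrix, map_sub, map_one]
  let r : {X // IsGood g X} → {X // IsGood g X} → Prop := fun Y X =>
    ∀ t : ParseForest g [Symbol.nonterminal Y.1], ∃ t' : ParseForest g [Symbol.nonterminal X.1],
      t'.yield = t.yield ∧ t.numNodes < t'.numNodes
  have : IsTrans _ r := ⟨fun X Y Z hXY hYZ t => by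
    obtain ⟨t', e, hn⟩ := hXY t
    obtain ⟨t'', e', hn'⟩ := hYZ t'
    exact ⟨t'', e'.trans e, hn.trans hn'⟩⟩
  -- Unambiguity enters here: trees with root X and equal yield coincide, so their node counts
  -- cannot differ.
  have : Std.Irrefl r := ⟨fun X h => by
    obtain ⟨t⟩ := X.2.2
    obtain ⟨t', e, hn⟩ := h t
    rw [X.2.1 e] at hn
    exact lt_irrefl _ hn⟩
  exact Matrix.det_one_sub_ne_zero_of_wellFounded _ r (Finite.wellFounded_of_trans_of_irrefl r)
    fun X Y h => exists_yield_eq_of_pderiv_ruleSystem_ne_zero X Y h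

/-- The generating function of an unambiguous context-free language is D-finite. -/
theorem IsUnambiguous.isDFinite [Finite T] (hg : g.IsUnambiguous) :
    g.language.generatingFunction.IsDFinite := by
  have hmem : ∀ t : g.ParseTree, t.yield ∈ g.language := fun t => by
    rw [mem_language_iff]
    exact t.derives_yield
  have hinj : YieldInjective g [Symbol.nonterminal g.initial] := fun t t' e =>
    (hg _ (hmem t')).unique e rfl
  have hgf : g.language.generatingFunction = forestSeries g [Symbol.nonterminal g.initial] := by
    ext n
    rw [forestSeries, coeff_sizeSeries, Language.generatingFunction, PowerSeries.coeff_mk,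
      ← Nat.card_coe_set_eq]
    congr 1
    refine (Nat.card_eq_of_bijective (fun t => ⟨t.1.yield, hmem t.1, t.2⟩) ⟨?_, ?_⟩).symm
    · intro t t' e
      exact Subtype.ext (hinj (congrArg Subtype.val e))
    · rintro ⟨w, hw, rfl⟩
      obtain ⟨t, rfl, -⟩ := hg w hw
      exact ⟨⟨t, rfl⟩, rfl⟩
  rw [hgf]
  -- If the language is empty, the initial nonterminal is not good, but the series is 0.
  rcases isEmpty_or_nonempty g.ParseTree with he | hne
  · rw [forestSeries, sizeSeries_of_isEmpty]
    exact ⟨0, 1, one_ne_zero, by simp⟩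
  · exact isDFinite_forestSeries ⟨hinj, hne⟩

end ContextFreeGrammar

/-! ### Counting shuffles -/

namespace Language

variable {A B : Type*}

/-- The word spelled by the letters from the first alphabet. -/
def leftWord (w : List (A ⊕ B)) : List A := w.filterMap Sum.getLeft?

/-- The word spelled by the letters from the second alphabet. -/
def rightWord (w : List (A ⊕ B)) : List B := w.filterMap Sum.getRight?

@[simp] lemma leftWord_nil : leftWord ([] : List (A ⊕ B)) = [] := rfl

@[simp] lemma leftWord_cons_inl (a : A) (w : List (A ⊕ B)) :
    leftWord (Sum.inl a :: w) = a :: leftWord w := rfl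

@[simp] lemma leftWord_cons_inr (b : B) (w : List (A ⊕ B)) :
    leftWord (Sum.inr b :: w) = leftWord w := rfl

@[simp] lemma rightWord_nil : rightWord ([] : List (A ⊕ B)) = [] := rfl

@[simp] lemma rightWord_cons_inl (a : A) (w : List (A ⊕ B)) :
    rightWord (Sum.inl a :: w) = rightWord w := rfl

@[simp] lemma rightWord_cons_inr (b : B) (w : List (A ⊕ B)) :
    rightWord (Sum.inr b :: w) = b :: rightWord w := rfl

/-- The words whose letters from the first alphabet spell `w₁` and whose letters from the second
alphabet spell `w₂`. -/
def interleavings (w₁ : List A) (w₂ : List B) : Set (List (A ⊕ B)) :=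
  {w | leftWord w = w₁ ∧ rightWord w = w₂}

lemma mem_interleavings {w₁ : List A} {w₂ : List B} {w : List (A ⊕ B)} :
    w ∈ interleavings w₁ w₂ ↔ leftWord w = w₁ ∧ rightWord w = w₂ := Iff.rfl

lemma mem_interleavings_nil_left (w : List (A ⊕ B)) (w₂ : List B) :
    w ∈ interleavings [] w₂ ↔ w = w₂.map Sum.inr := by
  induction w generalizing w₂ with
  | nil => cases w₂ <;> simp [mem_interleavings]
  | cons c w ih =>
    rcases c with a | b <;> rcases w₂ with _ | ⟨v, w₂⟩ <;>
      simp [mem_interleavings] at ih ⊢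
    simp [← ih]
    tauto

lemma mem_interleavings_nil_right (w : List (A ⊕ B)) (w₁ : List A) :
    w ∈ interleavings w₁ [] ↔ w = w₁.map Sum.inl := by
  induction w generalizing w₁ with
  | nil => cases w₁ <;> simp [mem_interleavings]
  | cons c w ih =>
    rcases c with a | b <;> rcases w₁ with _ | ⟨u, w₁⟩ <;>
      simp [mem_interleavings] at ih ⊢
    simp [← ih]
    tauto

lemma interleavings_cons_cons (u : A) (w₁ : List A) (v : B) (w₂ : List B) :
    interleavings (u :: w₁) (v :: w₂) =
      List.cons (Sum.inl u) '' interleavings w₁ (v :: w₂) ∪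
        List.cons (Sum.inr v) '' interleavings (u :: w₁) w₂ := by
  ext w
  rcases w with _ | ⟨a | b, w⟩
  · simp [mem_interleavings]
  · simp [mem_interleavings]
    tauto
  · simp [mem_interleavings]
    tauto

lemma singleton_mul_eq_image {T : Type*} (u : T) (L : Language T) :
    ({[u]} * L : Language T) = (List.cons u '' (L : Set (List T)) : Set (List T)) := by
  ext w
  rw [Language.mem_mul]
  constructor
  · rintro ⟨a, rfl, b, hb, rfl⟩
    exact ⟨b, hb, rfl⟩
  · rintro ⟨b, hb, rfl⟩
    exact ⟨[u], rfl, b, hb, rfl⟩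

/-- Over disjoint alphabets the recursive shuffle is a fibre of the two projections, so a shuffled
word remembers its factors. -/
lemma shuffleWords_map_inl_map_inr (w₁ : List A) (w₂ : List B) :
    (shuffleWords (w₁.map Sum.inl) (w₂.map Sum.inr) : Set (List (A ⊕ B))) =
      interleavings w₁ w₂ := by
  induction w₁ generalizing w₂ with
  | nil =>
    rw [List.map_nil, shuffleWords]
    exact Set.ext fun w => (mem_interleavings_nil_left w w₂).symm
  | cons u w₁ ih₁ =>
    induction w₂ with
    | nil =>
      rw [List.map_nil, List.map_cons, shuffleWords]
      exact Set.ext fun w => (mem_interleavings_nil_right w (u :: w₁)).symm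
    | cons v w₂ ih₂ =>
      rw [List.map_cons, List.map_cons, shuffleWords, interleavings_cons_cons, ← ih₁, ← ih₂,
        singleton_mul_eq_image, singleton_mul_eq_image]
      rfl

lemma finite_interleavings_and_ncard (w₁ : List A) (w₂ : List B) :
    (interleavings w₁ w₂).Finite ∧
      (interleavings w₁ w₂).ncard = (w₁.length + w₂.length).choose w₁.length := by
  induction w₁ generalizing w₂ with
  | nil =>
    have : (interleavings [] w₂ : Set (List (A ⊕ B))) = {w₂.map Sum.inr} :=
      Set.ext fun w => mem_interleavings_nil_left w w₂
    simp [this]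
  | cons u w₁ ih₁ =>
    induction w₂ with
    | nil =>
      have : (interleavings (u :: w₁) [] : Set (List (A ⊕ B))) = {(u :: w₁).map Sum.inl} :=
        Set.ext fun w => mem_interleavings_nil_right w _
      rw [this]
      simp
    | cons v w₂ ih₂ =>
      obtain ⟨hf₁, hc₁⟩ := ih₁ (v :: w₂)
      obtain ⟨hf₂, hc₂⟩ := ih₂
      rw [interleavings_cons_cons]
      refine ⟨(hf₁.image _).union (hf₂.image _), ?_⟩
      -- The first letter separates the two images, and the count obeys Pascal's rule.
      rw [Set.ncard_union_eq _ (hf₁.image _) (hf₂.image _),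
        Set.ncard_image_of_injective _ List.cons_injective,
        Set.ncard_image_of_injective _ List.cons_injective, hc₁, hc₂]
      · simp only [List.length_cons]
        rw [show w₁.length + 1 + (w₂.length + 1) = w₁.length + w₂.length + 1 + 1 by omega,
          Nat.choose_succ_succ]
        congr 2
        omega
      · rw [Set.disjoint_left]
        rintro _ ⟨_, _, rfl⟩ ⟨_, _, e⟩
        simp at e

lemma mem_shuffle_iff (L₁ : Language A) (L₂ : Language B) (w : List (A ⊕ B)) :
    w ∈ shuffle L₁ L₂ ↔ leftWord w ∈ L₁ ∧ rightWord w ∈ L₂ := by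
  constructor
  · rintro ⟨w₁, h₁, w₂, h₂, h⟩
    have h' : w ∈ interleavings w₁ w₂ := shuffleWords_map_inl_map_inr w₁ w₂ ▸ h
    obtain ⟨rfl, rfl⟩ := h'
    exact ⟨h₁, h₂⟩
  · rintro ⟨h₁, h₂⟩
    refine ⟨_, h₁, _, h₂, ?_⟩
    have h' : w ∈ interleavings (leftWord w) (rightWord w) :=
      ⟨rfl, rfl⟩
    rw [← shuffleWords_map_inl_map_inr] at h'
    exact h'

lemma length_leftWord_add_length_rightWord (w : List (A ⊕ B)) :
    (leftWord w).length + (rightWord w).length = w.length := by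
  induction w with
  | nil => rfl
  | cons c w ih =>
    rcases c with a | b <;> simp only [leftWord_cons_inl, leftWord_cons_inr, rightWord_cons_inl,
      rightWord_cons_inr, List.length_cons] <;> omega

lemma coeff_generatingFunction {T : Type*} (L : Language T) (n : ℕ) :
    PowerSeries.coeff n L.generatingFunction = (Nat.card {w // w ∈ L ∧ w.length = n} : ℚ) := by
  rw [generatingFunction, PowerSeries.coeff_mk, ← Nat.card_coe_set_eq]
  rfl

lemma finite_words_of_length {T : Type*} [Finite T] (L : Language T) (n : ℕ) :
    Finite {w // w ∈ L ∧ w.length = n} :=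
  ((List.finite_length_eq T n).subset fun _ hw => hw.2).to_subtype

lemma coeff_generatingFunction_shuffle [Finite A] [Finite B] (L₁ : Language A) (L₂ : Language B)
    (n : ℕ) :
    PowerSeries.coeff n (shuffle L₁ L₂).generatingFunction =
      ∑ k ∈ Finset.HasAntidiagonal.antidiagonal n, (n.choose k.1 : ℚ) *
        (PowerSeries.coeff k.1 L₁.generatingFunction *
          PowerSeries.coeff k.2 L₂.generatingFunction) := by
  classical
  simp only [coeff_generatingFunction]
  -- A shuffled word is classified by the lengths of its projections, then the projections, then the
  -- interleaving pattern.
  let e : {w // w ∈ shuffle L₁ L₂ ∧ w.length = n} ≃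
      Σ k : {k : ℕ × ℕ // k ∈ Finset.HasAntidiagonal.antidiagonal n},
        Σ p : {w // w ∈ L₁ ∧ w.length = k.1.1} × {w // w ∈ L₂ ∧ w.length = k.1.2},
          interleavings p.1.1 p.2.1 :=
    { toFun := fun w => ⟨⟨((leftWord w.1).length,
            (rightWord w.1).length),
          Finset.HasAntidiagonal.mem_antidiagonal.2
            ((length_leftWord_add_length_rightWord w.1).trans w.2.2)⟩,
        (⟨_, ((mem_shuffle_iff L₁ L₂ w.1).1 w.2.1).1, rfl⟩,
          ⟨_, ((mem_shuffle_iff L₁ L₂ w.1).1 w.2.1).2, rfl⟩), ⟨w.1, rfl, rfl⟩⟩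
      invFun := fun q => ⟨q.2.2.1, by
        obtain ⟨⟨k, hk⟩, ⟨⟨w₁, h₁, e₁⟩, ⟨w₂, h₂, e₂⟩⟩, ⟨w, hw⟩⟩ := q
        obtain ⟨hw₁, hw₂⟩ := hw
        dsimp only at hw₁ hw₂
        subst hw₁ hw₂
        refine ⟨(mem_shuffle_iff L₁ L₂ w).2 ⟨h₁, h₂⟩, ?_⟩
        rw [← length_leftWord_add_length_rightWord]
        dsimp only at e₁ e₂
        exact (congrArg₂ (· + ·) e₁ e₂).trans (Finset.HasAntidiagonal.mem_antidiagonal.1 hk)⟩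
      left_inv := fun w => rfl
      right_inv := by
        rintro ⟨⟨⟨a, b⟩, hk⟩, ⟨⟨w₁, h₁, e₁⟩, ⟨w₂, h₂, e₂⟩⟩, ⟨w, hw⟩⟩
        obtain ⟨hw₁, hw₂⟩ := hw
        dsimp only at hw₁ hw₂
        subst hw₁ hw₂
        dsimp only at e₁ e₂
        subst e₁ e₂
        rfl }
  have hA : ∀ k, Finite {w // w ∈ L₁ ∧ w.length = k} := finite_words_of_length L₁
  have hB : ∀ k, Finite {w // w ∈ L₂ ∧ w.length = k} := finite_words_of_length L₂
  have hI : ∀ (w₁ : List A) (w₂ : List B), Finite (interleavings w₁ w₂) := fun w₁ w₂ =>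
    (finite_interleavings_and_ncard w₁ w₂).1.to_subtype
  have hcard : ∀ k : ℕ × ℕ, k ∈ Finset.HasAntidiagonal.antidiagonal n →
      Nat.card (Σ p : {w // w ∈ L₁ ∧ w.length = k.1} × {w // w ∈ L₂ ∧ w.length = k.2},
          interleavings p.1.1 p.2.1) =
        n.choose k.1 * (Nat.card {w // w ∈ L₁ ∧ w.length = k.1} *
          Nat.card {w // w ∈ L₂ ∧ w.length = k.2}) := by
    intro k hk
    have := Fintype.ofFinite
      ({w // w ∈ L₁ ∧ w.length = k.1} × {w // w ∈ L₂ ∧ w.length = k.2})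
    rw [Nat.card_sigma, ← Nat.card_prod, Nat.card_eq_fintype_card, mul_comm]
    refine Finset.sum_const_nat fun p _ => ?_
    rw [Nat.card_coe_set_eq, (finite_interleavings_and_ncard _ _).2, p.1.2.2, p.2.2.2,
      Finset.HasAntidiagonal.mem_antidiagonal.1 hk]
  rw [Nat.card_congr e, Nat.card_sigma]
  push_cast
  rw [← Finset.sum_coe_sort (Finset.HasAntidiagonal.antidiagonal n)]
  refine Fintype.sum_congr _ _ fun k => ?_
  rw [hcard k.1 k.2]
  push_cast
  rfl

lemma exists_isUnambiguous {T : Type*} (L : Language T) (hcf : L.IsContextFree)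
    (h : ¬ L.IsInherentlyAmbiguous) :
    ∃ g : ContextFreeGrammar T, g.language = L ∧ g.IsUnambiguous := by
  by_contra! H
  exact h ⟨hcf, H⟩

end Language

theorem mainTheorem2 {A : Type*} {B : Type*} [Finite A] [Finite B]
    (L₁ : Language A) (L₂ : Language B)
    (hcf₁ : L₁.IsContextFree) (hcf₂ : L₂.IsContextFree)
    (hamb₁ : ¬ L₁.IsInherentlyAmbiguous) (hamb₂ : ¬ L₂.IsInherentlyAmbiguous) :
    (Language.shuffle L₁ L₂).generatingFunction.IsDFinite := by
  obtain ⟨g₁, rfl, h₁⟩ := L₁.exists_isUnambiguous hcf₁ hamb₁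
  obtain ⟨g₂, rfl, h₂⟩ := L₂.exists_isUnambiguous hcf₂ hamb₂
  exact h₁.isDFinite.of_binomial_convolution h₂.isDFinite
    (Language.coeff_generatingFunction_shuffle _ _)
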